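/- Let $(\Omega,\mathbb P)$ be a standard Borel probability space, let $\mathcal H,\mathcal A,\mathcal Y$ be standard Borel spaces with $\mathcal A\neq\varnothing$, and let $H:\Omega\to\mathcal H$ (the information at a terminal stage) and $Y:\Omega\to\mathcal Y$ (the target) be measurable. Let $\ell:\mathcal A\times\mathcal Y\to[0,\infty]$ be a measurable loss, let $\nu$ be a regular conditional distribution of $Y$ given $H$, and put $$\Lambda(h,a)=\mathbb E[\ell(a,Y)\mid H=h]=\int\ell(a,y)\,\nu_h(dy),\qquad R_a(h)=\inf_{a\in\mathcal A}\Lambda(h,a).$$ The stage may also escalate to human review, written $\triangle$, at conditional loss $R_h(H)$, where $R_h:\mathcal H\to[0,\infty]$ is universally measurable (for instance Borel) and $\mathbb E[R_h(H)]<\infty$. A policy is a universally measurable map $\delta:\mathcal H\to\mathcal A\cup\{\triangle\}$; its loss is $\ell(\delta(H),Y)$ where $\delta(H)\in\mathcal A$ and $R_h(H)$ where $\delta(H)=\triangle$. A randomized policy is a universally measurable Markov kernel from $\mathcal H$ to $\mathcal A\cup\{\triangle\}$, whose response is drawn conditionally independently of $Y$ given $H$. Then $R_a$ is universally measurable, and: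 1. the infimum of the expected loss over all policies, and also over all randomized policies, equals $\mathbb E[\min\{R_a(H),R_h(H)\}]$; 2. for every $\varepsilon>0$ there is a universally measurable $a_\varepsilon:\mathcal H\to\mathcal A$ such that the threshold rule that takes the action $a_\varepsilon(H)$ on $\{R_a(H)\le R_h(H)\}$ and escalates on $\{R_a(H)>R_h(H)\}$ is a policy whose expected loss is at most the optimal value plus $\varepsilon$; 3. for every universally measurable $a^*:\mathcal H\to\mathcal A$ with $\Lambda(H,a^*(H))=R_a(H)$ almost surely, the rule $$\delta^*(H)=\begin{cases}a^*(H),&R_a(H)\le R_h(H),\\ \triangle,&R_a(H)>R_h(H)\end{cases}$$ is a policy whose expected loss equals the optimal value. -/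

import Mathlib

open MeasureTheory ProbabilityTheory
open scoped ENNReal

namespace SelectiveReview

/-- The σ-algebra of universally measurable sets: the sets which lie in the completion of the
given σ-algebra with respect to every finite measure on it. -/
abbrev universalCompletion (α : Type*) [MeasurableSpace α] : MeasurableSpace α where
  MeasurableSet' s := ∀ μ : Measure α, IsFiniteMeasure μ → NullMeasurableSet s μ
  measurableSet_empty _ _ := MeasurableSet.empty.nullMeasurableSet
  measurableSet_compl _ hs μ hμ := (hs μ hμ).compl
  measurableSet_iUnion _ hs μ hμ := NullMeasurableSet.iUnion fun i => hs i μ hμ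

/-- A function is universally measurable if it is measurable with respect to the universal
completion of the σ-algebra of its domain. -/
def UniversallyMeasurable {α β : Type*} [MeasurableSpace α] [MeasurableSpace β]
    (f : α → β) : Prop :=
  Measurable[universalCompletion α] f

/-- The terminal actions when review is available: `automate a` for an action `a`,
or `escalate`. -/
abbrev Response (𝓐 : Type*) : Type _ := 𝓐 ⊕ Unit

/-- Take the automated action `a`. -/
abbrev automate {𝓐 : Type*} (a : 𝓐) : Response 𝓐 := Sum.inl a

/-- Escalate the case to human review. -/
abbrev escalate {𝓐 : Type*} : Response 𝓐 := Sum.inr ()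

section

variable {Ω 𝓗 𝓐 𝓨 : Type*} [MeasurableSpace Ω] [MeasurableSpace 𝓗] [MeasurableSpace 𝓐]
  [MeasurableSpace 𝓨]

/-- The loss of a response at information `h` and target `y`: the automated loss `ℓ a y`, or the
conditional loss `Rh h` of review. -/
def terminalLoss (ℓ : 𝓐 → 𝓨 → ℝ≥0∞) (Rh : 𝓗 → ℝ≥0∞) (d : Response 𝓐) (h : 𝓗) (y : 𝓨) : ℝ≥0∞ :=
  Sum.elim (fun a => ℓ a y) (fun _ => Rh h) d

/-- Expected loss of the deterministic policy that responds `δ h` at information `h`. -/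
noncomputable def policyLoss (P : Measure Ω) (H : Ω → 𝓗) (Y : Ω → 𝓨) (ℓ : 𝓐 → 𝓨 → ℝ≥0∞)
    (Rh : 𝓗 → ℝ≥0∞) (δ : 𝓗 → Response 𝓐) : ℝ≥0∞ :=
  ∫⁻ ω, terminalLoss ℓ Rh (δ (H ω)) (H ω) (Y ω) ∂P

/-- Expected loss of a randomized policy: at information `h` the response is drawn from `Γ h`,
independently of the target given the information. -/
noncomputable def randomizedLoss (P : Measure Ω) (H : Ω → 𝓗) (Y : Ω → 𝓨) (ℓ : 𝓐 → 𝓨 → ℝ≥0∞)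
    (Rh : 𝓗 → ℝ≥0∞) (Γ : @Kernel 𝓗 (Response 𝓐) (universalCompletion 𝓗) _) : ℝ≥0∞ :=
  ∫⁻ ω, ∫⁻ d, terminalLoss ℓ Rh d (H ω) (Y ω) ∂(Γ (H ω)) ∂P

/-- The optimal expected loss over all universally measurable deterministic policies. -/
noncomputable def optimalLoss (P : Measure Ω) (H : Ω → 𝓗) (Y : Ω → 𝓨) (ℓ : 𝓐 → 𝓨 → ℝ≥0∞)
    (Rh : 𝓗 → ℝ≥0∞) : ℝ≥0∞ :=
  ⨅ (δ : 𝓗 → Response 𝓐) (_ : UniversallyMeasurable δ), policyLoss P H Y ℓ Rh δ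

/-- The optimal expected loss over all universally measurable randomized policies. -/
noncomputable def optimalRandomizedLoss (P : Measure Ω) (H : Ω → 𝓗) (Y : Ω → 𝓨)
    (ℓ : 𝓐 → 𝓨 → ℝ≥0∞) (Rh : 𝓗 → ℝ≥0∞) : ℝ≥0∞ :=
  ⨅ (Γ : @Kernel 𝓗 (Response 𝓐) (universalCompletion 𝓗) _)
    (_ : @IsMarkovKernel 𝓗 (Response 𝓐) (universalCompletion 𝓗) _ Γ),
    randomizedLoss P H Y ℓ Rh Γ

/-- The posterior risk `E[ℓ(a, Y) | H = h]` of the action `a`, where `ν` is a regular conditional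
distribution of the target given the information. -/
noncomputable def posteriorRisk (ν : Kernel 𝓗 𝓨) (ℓ : 𝓐 → 𝓨 → ℝ≥0∞) (h : 𝓗) (a : 𝓐) : ℝ≥0∞ :=
  ∫⁻ y, ℓ a y ∂(ν h)

/-- The minimum automated posterior risk `inf_a E[ℓ(a, Y) | H = h]`. -/
noncomputable def minPosteriorRisk (ν : Kernel 𝓗 𝓨) (ℓ : 𝓐 → 𝓨 → ℝ≥0∞) (h : 𝓗) : ℝ≥0∞ :=
  ⨅ a, posteriorRisk ν ℓ h a

open Classical in
/-- The policy that takes the action `a h` where `Ra h ≤ Rh h` and escalates where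
`Rh h < Ra h`. -/
noncomputable def thresholdPolicy (Ra Rh : 𝓗 → ℝ≥0∞) (a : 𝓗 → 𝓐) (h : 𝓗) : Response 𝓐 :=
  if Ra h ≤ Rh h then automate (a h) else escalate

end

end SelectiveReview

/-! Conditioning on the information turns the loss of a policy into the expectation of
`responseRisk`, which is at least min(R_a, R_h) for every response. Randomizing only averages such
values, so it cannot beat this bound. The threshold rule nearly attains it once near-minimizing
actions are chosen measurably.

That choice is the substance of the proof, supplied by `exists_universallyMeasurable_selection`. A
nonempty Borel set in the product is a continuous image of the Baire space, and the leftmost point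
of each fibre is determined by the images of cylinders. These images are analytic, hence universally
measurable by a capacitability argument. The same fact about projections makes R_a universally
measurable. To disintegrate the joint law, `randomizedLoss_eq` replaces universally measurable data
by Borel versions, equal almost everywhere for the law of H. -/

namespace SelectiveReview

/-! ### Analytic sets are universally measurable. -/

section Capacitability

open Filter Topology Set

/-- The points of the Baire space whose first `k` coordinates are bounded by those of `m`. -/
def boundedPrefix (m : ℕ → ℕ) (k : ℕ) : Set (ℕ → ℕ) := {x | ∀ i < k, x i ≤ m i}

/-- The points of the Baire space all of whose coordinates are bounded by those of `m`. -/
def boundedBy (m : ℕ → ℕ) : Set (ℕ → ℕ) := {x | ∀ i, x i ≤ m i}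

theorem isCompact_boundedBy (m : ℕ → ℕ) : IsCompact (boundedBy m) := by
  have h : boundedBy m = Set.univ.pi fun i => Set.Iic (m i) := by
    ext x; simp [boundedBy, Pi.le_def]
  rw [h]
  exact isCompact_univ_pi fun i => (Set.finite_Iic (m i)).isCompact

theorem antitone_boundedPrefix (m : ℕ → ℕ) : Antitone (boundedPrefix m) :=
  fun _ _ hkl _ hx i hi => hx i (hi.trans_le hkl)

theorem boundedPrefix_update (m : ℕ → ℕ) (k n : ℕ) :
    boundedPrefix (Function.update m k n) (k + 1) = {x ∈ boundedPrefix m k | x k ≤ n} := by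
  ext x
  simp only [boundedPrefix, mem_ofPred_eq, Nat.lt_succ_iff_lt_or_eq]
  constructor
  · intro h
    refine ⟨fun i hi => ?_, by simpa using h k (Or.inr rfl)⟩
    simpa [Function.update_of_ne hi.ne] using h i (Or.inl hi)
  · rintro ⟨h, hk⟩ i (hi | rfl)
    · simpa [Function.update_of_ne hi.ne] using h i hi
    · simpa using hk

/-- An open set which contains all points bounded by `m` contains all points with a bounded
prefix of some length. -/
theorem exists_boundedPrefix_subset {U : Set (ℕ → ℕ)} (hU : IsOpen U) {m : ℕ → ℕ}
    (hm : boundedBy m ⊆ U) : ∃ k, boundedPrefix m k ⊆ U := by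
  by_contra! h
  choose x hx hxU using fun k => not_subset.1 (h k)
  -- Truncating at m puts the points in a compact set. Truncation leaves the first k coordinates of
  -- `x k` unchanged, so along the subsequence the untruncated points have the same limit.
  have hz : ∀ k, (fun i => min (x k i) (m i)) ∈ boundedBy m := fun k i => min_le_right _ _
  obtain ⟨z, hzm, φ, hφ, hlim⟩ := (isCompact_boundedBy m).tendsto_subseq hz
  have hlim' : Tendsto (x ∘ φ) atTop (𝓝 z) := by
    rw [tendsto_pi_nhds] at hlim ⊢
    intro i
    refine (hlim i).congr' ?_
    filter_upwards [eventually_gt_atTop i] with k hk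
    exact min_eq_left (hx (φ k) i (hk.trans_le (hφ.id_le k)))
  obtain ⟨k, hk⟩ := (hlim'.eventually (hU.mem_nhds (hm hzm))).exists
  exact hxU _ hk

variable {X : Type*} [TopologicalSpace X] [T2Space X] [MeasurableSpace X] [OpensMeasurableSpace X]

/-- Capacitability: a continuous image of the Baire space is approximated in measure by continuous
images of compact subsets. -/
theorem exists_le_measure_image_boundedBy (μ : Measure X) [IsFiniteMeasure μ] {g : (ℕ → ℕ) → X}
    (hg : Continuous g) {c : ℝ≥0∞} (hc : c < μ (range g)) :
    ∃ m, c ≤ μ (g '' boundedBy m) := by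
  have step : ∀ k (m : ℕ → ℕ), c < μ (g '' boundedPrefix m k) →
      ∃ n, c < μ (g '' boundedPrefix (Function.update m k n) (k + 1)) := by
    intro k m h
    have hun : g '' boundedPrefix m k =
        ⋃ n, g '' boundedPrefix (Function.update m k n) (k + 1) := by
      rw [← image_iUnion]
      congr 1
      ext x
      simp only [boundedPrefix_update, mem_iUnion, mem_sep_iff, exists_and_left, iff_self_and]
      exact fun _ => ⟨x k, le_rfl⟩
    have hmono : Monotone fun n => g '' boundedPrefix (Function.update m k n) (k + 1) := by
      intro a b hab
      simp only [boundedPrefix_update]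
      exact image_mono fun x hx => ⟨hx.1, hx.2.trans hab⟩
    -- Continuity from below holds for outer measures of arbitrary increasing sets, so no
    -- measurability of the images is needed.
    rw [hun, hmono.measure_iUnion] at h
    exact lt_iSup_iff.1 h
  choose! next hnext using step
  -- Stage k fixes coordinate k and never touches it again, so the final bound on coordinate i is
  -- read off at stage i + 1.
  let M : ℕ → ℕ → ℕ := fun k => Nat.rec 0 (fun k m => Function.update m k (next k m)) k
  have hMs : ∀ k, M (k + 1) = Function.update (M k) k (next k (M k)) := fun _ => rfl
  have hM : ∀ k, c < μ (g '' boundedPrefix (M k) k) := by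
    intro k
    induction k with
    | zero =>
      have : boundedPrefix (M 0) 0 = univ := by simp [boundedPrefix]
      rwa [this, image_univ]
    | succ k ih => exact hnext k _ ih
  let m : ℕ → ℕ := fun i => M (i + 1) i
  have hstable : ∀ k i, i < k → M k i = m i := by
    intro k
    induction k with
    | zero => simp
    | succ k ih =>
      intro i hi
      rcases Nat.lt_succ_iff_lt_or_eq.1 hi with h | rfl
      · rw [hMs, Function.update_of_ne h.ne, ih i h]
      · rfl
  have hpre : ∀ k, boundedPrefix (M k) k = boundedPrefix m k := by
    intro k
    ext x
    exact forall₂_congr fun i hi => by rw [hstable k i hi]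
  refine ⟨m, ?_⟩
  -- Continuity from above does need measurable sets; passing to closures provides them, and
  -- compactness of the limit image keeps the intersection from growing.
  have hanti : Antitone fun k => closure (g '' boundedPrefix m k) := fun k l hkl =>
    closure_mono (image_mono (antitone_boundedPrefix m hkl))
  have hsub : ⋂ k, closure (g '' boundedPrefix m k) ⊆ g '' boundedBy m := by
    intro y hy
    by_contra hyn
    obtain ⟨U, V, hU, hV, hUs, hyV, hUV⟩ := SeparatedNhds.of_isCompact_isCompact
      ((isCompact_boundedBy m).image hg) (isCompact_singleton (x := y))
      (disjoint_singleton_right.2 hyn)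
    obtain ⟨k, hk⟩ := exists_boundedPrefix_subset (hU.preimage hg) (image_subset_iff.1 hUs)
    obtain ⟨z, hzV, hzk⟩ := mem_closure_iff.1 (mem_iInter.1 hy k) V hV (hyV rfl)
    exact hUV.le_bot ⟨image_subset_iff.2 hk hzk, hzV⟩
  calc c ≤ ⨅ k, μ (closure (g '' boundedPrefix m k)) :=
        le_iInf fun k => (hpre k ▸ hM k).le.trans (measure_mono subset_closure)
    _ = μ (⋂ k, closure (g '' boundedPrefix m k)) :=
        (hanti.measure_iInter (fun k => isClosed_closure.measurableSet.nullMeasurableSet)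
          ⟨0, measure_ne_top _ _⟩).symm
    _ ≤ μ (g '' boundedBy m) := measure_mono hsub

/-- Countably many compact images exhaust the outer measure of the range, so their union is a Borel
subset of full measure. -/
theorem nullMeasurableSet_range_of_continuous (μ : Measure X) [IsFiniteMeasure μ]
    {g : (ℕ → ℕ) → X} (hg : Continuous g) : NullMeasurableSet (range g) μ := by
  by_cases h0 : μ (range g) = 0
  · exact NullMeasurableSet.of_null h0
  obtain ⟨c, -, hc, hlim⟩ := exists_seq_strictMono_tendsto' (pos_iff_ne_zero.2 h0)
  choose m hm using fun n => exists_le_measure_image_boundedBy μ hg (hc n).2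
  let T : Set X := ⋃ n, g '' boundedBy (m n)
  have hTm : MeasurableSet T := MeasurableSet.iUnion fun n =>
    ((isCompact_boundedBy (m n)).image hg).isClosed.measurableSet
  have hTs : T ⊆ range g := iUnion_subset fun n => image_subset_range _ _
  have hle : μ (range g) ≤ μ T := le_of_tendsto' hlim fun n =>
    (hm n).trans (measure_mono (subset_iUnion (fun n => g '' boundedBy (m n)) n))
  exact hTm.nullMeasurableSet.congr
    (ae_eq_of_subset_of_measure_ge hTs hle hTm.nullMeasurableSet (measure_ne_top _ _))

/-- Analytic sets are universally measurable. -/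
theorem measurableSet_universalCompletion_of_analyticSet {s : Set X} (hs : AnalyticSet s) :
    MeasurableSet[universalCompletion X] s := by
  intro μ hμ
  rw [AnalyticSet] at hs
  rcases hs with rfl | ⟨g, hg, rfl⟩
  · exact MeasurableSet.empty.nullMeasurableSet
  · exact nullMeasurableSet_range_of_continuous μ hg

end Capacitability

/-! ### Jankov–von Neumann selection by leftmost points of fibres. -/

section Selection

open Set

/-- The points of the Baire space which extend the finite sequence `l`. -/
def listCylinder (l : List ℕ) : Set (ℕ → ℕ) := {x | ∀ i (h : i < l.length), x i = l[i]}

theorem listCylinder_nil : listCylinder [] = univ := by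
  ext x; simp [listCylinder]

theorem mem_listCylinder_append {l : List ℕ} {n : ℕ} {x : ℕ → ℕ} :
    x ∈ listCylinder (l ++ [n]) ↔ x ∈ listCylinder l ∧ x l.length = n := by
  simp only [listCylinder, mem_ofPred_eq, List.length_append, List.length_singleton]
  constructor
  · intro h
    refine ⟨fun i hi => ?_, by simpa using h l.length (by simp)⟩
    have := h i (by omega)
    rwa [List.getElem_append_left hi] at this
  · rintro ⟨h, hn⟩ i hi
    rcases Nat.lt_succ_iff_lt_or_eq.1 hi with hi' | rfl
    · rw [List.getElem_append_left hi', h i hi']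
    · simpa using hn

theorem isClosed_listCylinder (l : List ℕ) : IsClosed (listCylinder l) := by
  simp only [listCylinder, ofPred_forall]
  exact isClosed_iInter fun i => isClosed_iInter fun hi =>
    isClosed_eq (continuous_apply i) continuous_const

variable {X : Type*} (g : (ℕ → ℕ) → X)

open Classical in
/-- The least next digit of a point of the fibre of `g` over `x` which extends `l`. -/
noncomputable def leastDigit (l : List ℕ) (x : X) : ℕ :=
  if h : ∃ n, x ∈ g '' listCylinder (l ++ [n]) then Nat.find h else 0

/-- The first `k` digits of the leftmost point of the fibre of `g` over `x`. -/
noncomputable def leftmostPrefix (x : X) : ℕ → List ℕ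
  | 0 => []
  | k + 1 => leftmostPrefix x k ++ [leastDigit g (leftmostPrefix x k) x]

/-- The leftmost point of the fibre of `g` over `x`. -/
noncomputable def leftmostPoint (x : X) (k : ℕ) : ℕ := leastDigit g (leftmostPrefix g x k) x

theorem length_leftmostPrefix (x : X) (k : ℕ) : (leftmostPrefix g x k).length = k := by
  induction k with
  | zero => rfl
  | succ k ih => simp [leftmostPrefix, ih]

theorem mem_image_listCylinder_leftmostPrefix {x : X} (hx : x ∈ range g) (k : ℕ) :
    x ∈ g '' listCylinder (leftmostPrefix g x k) := by
  induction k with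
  | zero => rwa [leftmostPrefix, listCylinder_nil, image_univ]
  | succ k ih =>
    obtain ⟨z, hz, hzx⟩ := ih
    have h : ∃ n, x ∈ g '' listCylinder (leftmostPrefix g x k ++ [n]) :=
      ⟨_, z, mem_listCylinder_append.2 ⟨hz, rfl⟩, hzx⟩
    rw [leftmostPrefix, leastDigit, dif_pos h]
    classical exact Nat.find_spec h

theorem leftmostPoint_eq_of_mem {x : X} {k : ℕ} {z : ℕ → ℕ}
    (hz : z ∈ listCylinder (leftmostPrefix g x k)) : ∀ i < k, z i = leftmostPoint g x i := by
  induction k with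
  | zero => simp
  | succ k ih =>
    intro i hi
    rw [leftmostPrefix, mem_listCylinder_append, length_leftmostPrefix] at hz
    rcases Nat.lt_succ_iff_lt_or_eq.1 hi with h | rfl
    · exact ih hz.1 i h
    · exact hz.2

/-- Fibre points sharing ever longer prefixes with the leftmost point converge to it, and g is
constantly x along them. -/
theorem apply_leftmostPoint [TopologicalSpace X] [T1Space X] (hg : Continuous g) {x : X}
    (hx : x ∈ range g) : g (leftmostPoint g x) = x := by
  choose z hz hzx using mem_image_listCylinder_leftmostPrefix g hx
  have hlim : Filter.Tendsto z Filter.atTop (nhds (leftmostPoint g x)) := by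
    rw [tendsto_pi_nhds]
    intro i
    refine tendsto_const_nhds.congr' ?_
    filter_upwards [Filter.eventually_gt_atTop i] with k hk
    exact (leftmostPoint_eq_of_mem g (hz k) i hk).symm
  have h1 : g (leftmostPoint g x) ∈ ({x} : Set X) :=
    isClosed_singleton.mem_of_tendsto ((hg.tendsto _).comp hlim)
      (Filter.Eventually.of_forall fun k => hzx k)
  exact h1

/-- The σ-algebra on X is unrelated to any topology, so the universal completion can be used. -/
theorem measurable_leftmostPoint [MeasurableSpace X]
    (hg : ∀ l, MeasurableSet (g '' listCylinder l)) : Measurable (leftmostPoint g) := by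
  classical
  have hd : ∀ l, Measurable (leastDigit g l) := by
    intro l
    refine measurable_to_nat fun y => ?_
    have hE : MeasurableSet {x | ∃ n, x ∈ g '' listCylinder (l ++ [n])} := by
      rw [ofPred_exists]; exact MeasurableSet.iUnion fun n => hg _
    have hfib : ∀ n, MeasurableSet {x | leastDigit g l x = n} := by
      intro n
      -- The first piece accounts for the default digit 0 when no extension meets the fibre.
      have : {x | leastDigit g l x = n} =
          ({x | ∃ n, x ∈ g '' listCylinder (l ++ [n])}ᶜ ∩ {_x | 0 = n}) ∪
          (g '' listCylinder (l ++ [n]) ∩ ⋂ j, ⋂ (_ : j < n), (g '' listCylinder (l ++ [j]))ᶜ) := by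
        ext x
        by_cases h : ∃ n, x ∈ g '' listCylinder (l ++ [n])
        · have hl : leastDigit g l x = Nat.find h := dif_pos h
          simp only [hl, mem_ofPred_eq, Nat.find_eq_iff, mem_union, mem_inter_iff,
            mem_compl_iff, h, not_true_eq_false, false_and, false_or, mem_iInter]
        · have h' := not_exists.1 h
          have hl : leastDigit g l x = 0 := dif_neg h
          simp only [hl, mem_ofPred_eq, mem_union, mem_inter_iff,
            mem_compl_iff, h, not_false_eq_true, true_and, h' n, false_and, or_false]
      rw [this]
      exact (hE.compl.inter (MeasurableSet.const _)).union
        ((hg _).inter (MeasurableSet.iInter fun j => MeasurableSet.iInter fun _ => (hg _).compl))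
    exact hfib _
  -- Prefixes take countably many values, so measurability for each fixed prefix gives joint
  -- measurability.
  let : MeasurableSpace (List ℕ) := ⊤
  have hcomp : Measurable fun p : List ℕ × X => leastDigit g p.1 p.2 :=
    measurable_from_prod_countable_right hd
  have hp : ∀ k, Measurable fun x => leftmostPrefix g x k := by
    intro k
    induction k with
    | zero => exact measurable_const
    | succ k ih =>
      have hap : Measurable fun p : List ℕ × ℕ => p.1 ++ [p.2] := measurable_of_countable _
      exact hap.comp (ih.prodMk (hcomp.comp (ih.prodMk measurable_id)))
  exact measurable_pi_lambda _ fun k => hcomp.comp ((hp k).prodMk measurable_id)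

/-- The Jankov–von Neumann selection theorem: a measurable subset of a product of standard Borel
spaces has a universally measurable uniformization. -/
theorem exists_universallyMeasurable_selection {X A : Type*} [MeasurableSpace X]
    [StandardBorelSpace X] [MeasurableSpace A] [StandardBorelSpace A] [Nonempty A]
    {B : Set (X × A)} (hB : MeasurableSet B) :
    ∃ f : X → A, UniversallyMeasurable f ∧ ∀ x a, (x, a) ∈ B → (x, f x) ∈ B := by
  let := upgradeStandardBorel X
  let := upgradeStandardBorel A
  have hBa : AnalyticSet B := hB.analyticSet
  rw [AnalyticSet] at hBa
  rcases hBa with rfl | ⟨φ, hφ, rfl⟩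
  · exact ⟨fun _ => Classical.arbitrary A, @measurable_const _ _ _ (universalCompletion X) _,
      by simp⟩
  have hg : Continuous fun z => (φ z).1 := continuous_fst.comp hφ
  refine ⟨fun x => (φ (leftmostPoint (fun z => (φ z).1) x)).2, ?_, ?_⟩
  · have h2 : Measurable fun z => (φ z).2 := (continuous_snd.comp hφ).measurable
    exact @Measurable.comp _ _ _ (universalCompletion X) _ _ (fun z => (φ z).2) _ h2
      (@measurable_leftmostPoint _ _ (universalCompletion X) fun l =>
        measurableSet_universalCompletion_of_analyticSet
          ((isClosed_listCylinder l).analyticSet.image_of_continuous hg))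
  · rintro x a ⟨z, hz⟩
    have hx : (φ (leftmostPoint (fun z => (φ z).1) x)).1 = x :=
      apply_leftmostPoint (fun z => (φ z).1) hg ⟨z, by simp [hz]⟩
    exact ⟨_, Prod.ext hx rfl⟩

theorem measurableSet_universalCompletion_image_fst {X A : Type*} [MeasurableSpace X]
    [StandardBorelSpace X] [MeasurableSpace A] [StandardBorelSpace A]
    {B : Set (X × A)} (hB : MeasurableSet B) :
    MeasurableSet[universalCompletion X] (Prod.fst '' B) := by
  let := upgradeStandardBorel X
  let := upgradeStandardBorel A
  exact measurableSet_universalCompletion_of_analyticSet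
    (hB.analyticSet.image_of_continuous continuous_fst)

end Selection


/-! ### Borel versions of universally measurable maps and kernels. -/

section UniversalMeasurability

variable {α β : Type*} [MeasurableSpace α] [MeasurableSpace β]

theorem UniversallyMeasurable.nullMeasurable {f : α → β} (hf : UniversallyMeasurable f)
    (μ : Measure α) [IsFiniteMeasure μ] : NullMeasurable f μ :=
  fun _ hs => hf hs μ inferInstance

theorem UniversallyMeasurable.aemeasurable [MeasurableSpace.CountablyGenerated β] {f : α → β}
    (hf : UniversallyMeasurable f) (μ : Measure α) [IsFiniteMeasure μ] : AEMeasurable f μ :=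
  (hf.nullMeasurable μ).aemeasurable

instance countablyGenerated_response [Nonempty α] [MeasurableSpace.CountablyGenerated α] :
    MeasurableSpace.CountablyGenerated (Response α) := by
  obtain ⟨a₀⟩ := ‹Nonempty α›
  let φ : Response α → α × Bool := Sum.elim (fun a => (a, true)) (fun _ => (a₀, false))
  have hφ : Measurable φ :=
    measurable_id.prodMk measurable_const |>.sumElim measurable_const
  have hcomap : Sum.instMeasurableSpace = MeasurableSpace.comap φ inferInstance := by
    refine le_antisymm (fun s hs => ?_) hφ.comap_le
    have h1 : MeasurableSet (Sum.inl ⁻¹' s : Set α) := measurable_inl hs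
    by_cases hu : (Sum.inr () : Response α) ∈ s
    · refine ⟨(Sum.inl ⁻¹' s) ×ˢ {true} ∪ Set.univ ×ˢ {false},
        (h1.prod (measurableSet_singleton _)).union
          (MeasurableSet.univ.prod (measurableSet_singleton _)), ?_⟩
      ext (a | u) <;> simp [φ, hu]
    · refine ⟨(Sum.inl ⁻¹' s) ×ˢ {true}, h1.prod (measurableSet_singleton _), ?_⟩
      ext (a | u) <;> simp [φ, hu]
  exact hcomap ▸ MeasurableSpace.CountablyGenerated.comap φ

/-- A universally measurable Markov kernel agrees almost everywhere with a measurable one. -/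
theorem exists_kernel_ae_eq [Nonempty β] [MeasurableSpace.CountablyGenerated β]
    (Γ : @Kernel α β (universalCompletion α) _)
    [hΓ : @IsMarkovKernel α β (universalCompletion α) _ Γ] (μ : Measure α) [IsFiniteMeasure μ] :
    ∃ Γ' : Kernel α β, IsMarkovKernel Γ' ∧ ∀ᵐ x ∂μ, Γ x = Γ' x := by
  classical
  -- Countability merges the exceptional sets into one null set; being a π-system that generates, S
  -- suffices to test measurability of the kernel.
  let S := generateSetAlgebra (MeasurableSpace.countableGeneratingSet β)
  have hSc : S.Countable :=
    countable_generateSetAlgebra (MeasurableSpace.countable_countableGeneratingSet)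
  have hgen : ‹MeasurableSpace β› = MeasurableSpace.generateFrom S := by
    rw [generateFrom_generateSetAlgebra_eq, MeasurableSpace.generateFrom_countableGeneratingSet]
  have hpi : IsPiSystem S := fun s hs t ht _ =>
    isSetAlgebra_generateSetAlgebra.inter_mem hs ht
  have hSm : ∀ s ∈ S, MeasurableSet s := fun s hs => by
    rw [hgen]; exact MeasurableSpace.measurableSet_generateFrom hs
  have hU : ∀ s ∈ S, AEMeasurable (fun x => Γ x s) μ := fun s hs =>
    UniversallyMeasurable.aemeasurable
      (@Kernel.measurable_coe _ _ (universalCompletion α) _ Γ s (hSm s hs)) μ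
  have hae : ∀ᵐ x ∂μ, ∀ s (hs : s ∈ S), Γ x s = (hU s hs).mk _ x :=
    (ae_ball_iff hSc).2 fun s hs => (hU s hs).ae_eq_mk
  let N := toMeasurable μ {x | ¬ ∀ s (hs : s ∈ S), Γ x s = (hU s hs).mk _ x}
  have hN : μ N = 0 := by rw [measure_toMeasurable]; exact hae
  have hNm : MeasurableSet N := measurableSet_toMeasurable _ _
  -- A Dirac mass on the null set keeps the kernel Markov everywhere.
  let κ : α → Measure β := fun x => if x ∈ N then Measure.dirac (Classical.arbitrary β) else Γ x
  have hκ : ∀ x, IsProbabilityMeasure (κ x) := fun x => by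
    by_cases h : x ∈ N
    · simp only [κ, if_pos h]; infer_instance
    · simp only [κ, if_neg h]
      exact @IsMarkovKernel.isProbabilityMeasure _ _ (universalCompletion α) _ Γ hΓ x
  have hκm : Measurable κ := by
    refine Measurable.measure_of_isPiSystem_of_isProbabilityMeasure hgen hpi fun s hs => ?_
    have : (fun x => κ x s) = fun x =>
        if x ∈ N then Measure.dirac (Classical.arbitrary β) s else (hU s hs).mk _ x := by
      funext x
      by_cases h : x ∈ N
      · simp only [κ, if_pos h]
      · simp only [κ, if_neg h]
        have hx := fun h' => h (subset_toMeasurable μ _ h')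
        exact (not_not.1 hx) s hs
    rw [this]
    exact Measurable.ite hNm measurable_const (hU s hs).measurable_mk
  refine ⟨⟨κ, hκm⟩, ⟨hκ⟩, ?_⟩
  filter_upwards [measure_eq_zero_iff_ae_notMem.1 hN] with x hx
  exact (if_neg hx).symm

end UniversalMeasurability

/-! ### Conditional risk of policies and near-minimizing actions. -/

section Risk

set_option linter.unusedSectionVars false

variable {Ω 𝓗 𝓐 𝓨 : Type*} [MeasurableSpace Ω] [MeasurableSpace 𝓗] [MeasurableSpace 𝓐]
  [MeasurableSpace 𝓨]

/-- The conditional expected loss of a response given the information. -/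
noncomputable def responseRisk (ν : Kernel 𝓗 𝓨) (ℓ : 𝓐 → 𝓨 → ℝ≥0∞) (Rh : 𝓗 → ℝ≥0∞) (h : 𝓗)
    (d : Response 𝓐) : ℝ≥0∞ :=
  Sum.elim (posteriorRisk ν ℓ h) (fun _ => Rh h) d

theorem lintegral_terminalLoss (ν : Kernel 𝓗 𝓨) [IsMarkovKernel ν] (ℓ : 𝓐 → 𝓨 → ℝ≥0∞)
    (Rh : 𝓗 → ℝ≥0∞) (h : 𝓗) (d : Response 𝓐) :
    ∫⁻ y, terminalLoss ℓ Rh d h y ∂(ν h) = responseRisk ν ℓ Rh h d := by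
  rcases d with a | u
  · rfl
  · simp [terminalLoss, responseRisk]

theorem min_le_responseRisk (ν : Kernel 𝓗 𝓨) (ℓ : 𝓐 → 𝓨 → ℝ≥0∞) (Rh : 𝓗 → ℝ≥0∞) (h : 𝓗)
    (d : Response 𝓐) : min (minPosteriorRisk ν ℓ h) (Rh h) ≤ responseRisk ν ℓ Rh h d := by
  rcases d with a | u
  · exact (min_le_left _ _).trans (iInf_le _ a)
  · exact min_le_right _ _

theorem measurable_terminalLoss {ℓ : 𝓐 → 𝓨 → ℝ≥0∞} (hℓ : Measurable (Function.uncurry ℓ))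
    {Rh : 𝓗 → ℝ≥0∞} (hRh : Measurable Rh) :
    Measurable fun p : Response 𝓐 × 𝓗 × 𝓨 => terminalLoss ℓ Rh p.1 p.2.1 p.2.2 := by
  have h : Measurable (Sum.elim (fun q : 𝓐 × 𝓗 × 𝓨 => ℓ q.1 q.2.2)
      (fun q : Unit × 𝓗 × 𝓨 => Rh q.2.1)) :=
    (hℓ.comp (measurable_fst.prodMk measurable_snd.snd)).sumElim
      (hRh.comp measurable_snd.fst)
  convert h.comp (MeasurableEquiv.sumProdDistrib 𝓐 Unit (𝓗 × 𝓨)).measurable using 1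
  funext ⟨d, h, y⟩
  rcases d with a | u <;> rfl

theorem measurable_terminalLoss_response (ℓ : 𝓐 → 𝓨 → ℝ≥0∞) (hℓ : Measurable (Function.uncurry ℓ))
    (Rh : 𝓗 → ℝ≥0∞) (h : 𝓗) (y : 𝓨) : Measurable fun d => terminalLoss ℓ Rh d h y :=
  (hℓ.comp (measurable_id.prodMk measurable_const)).sumElim measurable_const

theorem measurable_responseRisk_response (ν : Kernel 𝓗 𝓨) [IsMarkovKernel ν] (ℓ : 𝓐 → 𝓨 → ℝ≥0∞)
    (hℓ : Measurable (Function.uncurry ℓ)) (Rh : 𝓗 → ℝ≥0∞) (h : 𝓗) :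
    Measurable (responseRisk ν ℓ Rh h) :=
  (Measurable.lintegral_prod_right' hℓ).sumElim measurable_const

variable {P : Measure Ω} [IsProbabilityMeasure P] {H : Ω → 𝓗} {Y : Ω → 𝓨}
  {ν : Kernel 𝓗 𝓨} [IsMarkovKernel ν] {ℓ : 𝓐 → 𝓨 → ℝ≥0∞} {Rh : 𝓗 → ℝ≥0∞}

/-- The expected loss of a randomized policy is the expectation of its conditional risk. -/
theorem randomizedLoss_eq [Nonempty 𝓐] [MeasurableSpace.CountablyGenerated 𝓐] (hH : Measurable H)
    (hν : HasCondDistrib Y H ν P) (hℓ : Measurable (Function.uncurry ℓ))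
    (hRh : UniversallyMeasurable Rh)
    (Γ : @Kernel 𝓗 (Response 𝓐) (universalCompletion 𝓗) _)
    [hΓ : @IsMarkovKernel 𝓗 (Response 𝓐) (universalCompletion 𝓗) _ Γ] :
    randomizedLoss P H Y ℓ Rh Γ = ∫⁻ ω, ∫⁻ d, responseRisk ν ℓ Rh (H ω) d ∂(Γ (H ω)) ∂P := by
  have : IsProbabilityMeasure (P.map H) := Measure.isProbabilityMeasure_map hH.aemeasurable
  have hRa := hRh.aemeasurable (P.map H)
  let R := hRa.mk Rh
  have hR : Measurable R := hRa.measurable_mk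
  obtain ⟨Γ', _, hΓ'⟩ := exists_kernel_ae_eq Γ (P.map H)
  have hRω : ∀ᵐ ω ∂P, Rh (H ω) = R (H ω) := ae_of_ae_map hH.aemeasurable hRa.ae_eq_mk
  have hΓω : ∀ᵐ ω ∂P, Γ (H ω) = Γ' (H ω) := ae_of_ae_map hH.aemeasurable hΓ'
  have hloss : ∀ d h y, Rh h = R h → terminalLoss ℓ Rh d h y = terminalLoss ℓ R d h y := by
    intro d h y e
    rcases d with a | u
    · rfl
    · exact e
  have hrisk : ∀ h d, Rh h = R h → responseRisk ν ℓ Rh h d = responseRisk ν ℓ R h d := by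
    intro h d e
    rcases d with a | u
    · rfl
    · exact e
  have hF : Measurable fun p : 𝓗 × 𝓨 => ∫⁻ d, terminalLoss ℓ R d p.1 p.2 ∂(Γ' p.1) := by
    have := Measurable.lintegral_kernel_prod_right' (κ := Γ'.comap Prod.fst measurable_fst)
      ((measurable_terminalLoss hℓ hR).comp
        (measurable_swap (α := 𝓗 × 𝓨) (β := Response 𝓐)))
    exact this
  have hG : Measurable fun h => ∫⁻ d, responseRisk ν ℓ R h d ∂(Γ' h) := by
    refine Measurable.lintegral_kernel_prod_right'
      (f := fun p : 𝓗 × Response 𝓐 => responseRisk ν ℓ R p.1 p.2) ?_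
    simp_rw [← lintegral_terminalLoss ν ℓ R]
    exact Measurable.lintegral_kernel_prod_right' (κ := ν.comap Prod.fst measurable_fst)
      (f := fun q : (𝓗 × Response 𝓐) × 𝓨 => terminalLoss ℓ R q.1.2 q.1.1 q.2)
      ((measurable_terminalLoss hℓ hR).comp
        (measurable_fst.snd.prodMk (measurable_fst.fst.prodMk measurable_snd)))
  calc randomizedLoss P H Y ℓ Rh Γ
      = ∫⁻ ω, ∫⁻ d, terminalLoss ℓ R d (H ω) (Y ω) ∂(Γ' (H ω)) ∂P := by
        refine lintegral_congr_ae ?_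
        filter_upwards [hRω, hΓω] with ω h1 h2
        rw [h2]
        exact lintegral_congr fun d => hloss d _ _ h1
    _ = ∫⁻ p, ∫⁻ d, terminalLoss ℓ R d p.1 p.2 ∂(Γ' p.1) ∂(P.map fun ω => (H ω, Y ω)) :=
        (lintegral_map' hF.aemeasurable hν.aemeasurable).symm
    _ = ∫⁻ h, ∫⁻ y, ∫⁻ d, terminalLoss ℓ R d h y ∂(Γ' h) ∂(ν h) ∂(P.map H) := by
        rw [hν.map_eq, Measure.lintegral_compProd hF]
    _ = ∫⁻ h, ∫⁻ d, responseRisk ν ℓ R h d ∂(Γ' h) ∂(P.map H) := by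
        refine lintegral_congr fun h => ?_
        -- Tonelli at fixed h: response and target are conditionally independent.
        rw [lintegral_lintegral_swap]
        · exact lintegral_congr fun d => lintegral_terminalLoss ν ℓ R h d
        · exact ((measurable_terminalLoss hℓ hR).comp
            (measurable_snd.prodMk (measurable_const.prodMk measurable_fst))).aemeasurable
    _ = ∫⁻ ω, ∫⁻ d, responseRisk ν ℓ R (H ω) d ∂(Γ' (H ω)) ∂P := lintegral_map hG hH
    _ = ∫⁻ ω, ∫⁻ d, responseRisk ν ℓ Rh (H ω) d ∂(Γ (H ω)) ∂P := by
        refine lintegral_congr_ae ?_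
        filter_upwards [hRω, hΓω] with ω h1 h2
        rw [h2]
        exact lintegral_congr fun d => (hrisk _ d h1).symm

/-- A deterministic policy as a randomized policy. -/
noncomputable def deterministicKernel {δ : 𝓗 → Response 𝓐} (hδ : UniversallyMeasurable δ) :
    @Kernel 𝓗 (Response 𝓐) (universalCompletion 𝓗) _ :=
  @Kernel.deterministic 𝓗 (Response 𝓐) (universalCompletion 𝓗) _ δ hδ

theorem isMarkovKernel_deterministicKernel {δ : 𝓗 → Response 𝓐} (hδ : UniversallyMeasurable δ) :
    @IsMarkovKernel 𝓗 (Response 𝓐) (universalCompletion 𝓗) _ (deterministicKernel hδ) :=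
  @Kernel.isMarkovKernel_deterministic 𝓗 (Response 𝓐) (universalCompletion 𝓗) _ δ hδ

theorem deterministicKernel_apply {δ : 𝓗 → Response 𝓐} (hδ : UniversallyMeasurable δ) (h : 𝓗) :
    deterministicKernel hδ h = Measure.dirac (δ h) :=
  @Kernel.deterministic_apply 𝓗 (Response 𝓐) (universalCompletion 𝓗) _ δ hδ h

theorem randomizedLoss_deterministicKernel (hℓ : Measurable (Function.uncurry ℓ))
    {δ : 𝓗 → Response 𝓐} (hδ : UniversallyMeasurable δ) :
    randomizedLoss P H Y ℓ Rh (deterministicKernel hδ) = policyLoss P H Y ℓ Rh δ := by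
  refine lintegral_congr fun ω => ?_
  rw [deterministicKernel_apply,
    lintegral_dirac' _ (measurable_terminalLoss_response ℓ hℓ Rh (H ω) (Y ω))]

/-- The expected loss of a deterministic policy is the expectation of its conditional risk. -/
theorem policyLoss_eq [Nonempty 𝓐] [MeasurableSpace.CountablyGenerated 𝓐] (hH : Measurable H)
    (hν : HasCondDistrib Y H ν P) (hℓ : Measurable (Function.uncurry ℓ))
    (hRh : UniversallyMeasurable Rh) {δ : 𝓗 → Response 𝓐} (hδ : UniversallyMeasurable δ) :
    policyLoss P H Y ℓ Rh δ = ∫⁻ ω, responseRisk ν ℓ Rh (H ω) (δ (H ω)) ∂P := by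
  have := isMarkovKernel_deterministicKernel hδ
  rw [← randomizedLoss_deterministicKernel hℓ hδ, randomizedLoss_eq hH hν hℓ hRh]
  refine lintegral_congr fun ω => ?_
  rw [deterministicKernel_apply,
    lintegral_dirac' _ (measurable_responseRisk_response ν ℓ hℓ Rh (H ω))]

theorem lintegral_min_le_randomizedLoss [Nonempty 𝓐] [MeasurableSpace.CountablyGenerated 𝓐] (hH : Measurable H)
    (hν : HasCondDistrib Y H ν P) (hℓ : Measurable (Function.uncurry ℓ))
    (hRh : UniversallyMeasurable Rh)
    (Γ : @Kernel 𝓗 (Response 𝓐) (universalCompletion 𝓗) _)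
    [hΓ : @IsMarkovKernel 𝓗 (Response 𝓐) (universalCompletion 𝓗) _ Γ] :
    ∫⁻ ω, min (minPosteriorRisk ν ℓ (H ω)) (Rh (H ω)) ∂P ≤ randomizedLoss P H Y ℓ Rh Γ := by
  rw [randomizedLoss_eq hH hν hℓ hRh]
  refine lintegral_mono fun ω => ?_
  have := @IsMarkovKernel.isProbabilityMeasure _ _ (universalCompletion 𝓗) _ Γ hΓ (H ω)
  calc min (minPosteriorRisk ν ℓ (H ω)) (Rh (H ω))
      = ∫⁻ _, min (minPosteriorRisk ν ℓ (H ω)) (Rh (H ω)) ∂(Γ (H ω)) := by simp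
    _ ≤ _ := lintegral_mono fun d => min_le_responseRisk ν ℓ Rh (H ω) d

theorem measurable_posteriorRisk (hℓ : Measurable (Function.uncurry ℓ)) :
    Measurable fun p : 𝓗 × 𝓐 => posteriorRisk ν ℓ p.1 p.2 :=
  Measurable.lintegral_kernel_prod_right' (κ := ν.comap Prod.fst measurable_fst)
    (f := fun q : (𝓗 × 𝓐) × 𝓨 => ℓ q.1.2 q.2)
    (hℓ.comp (measurable_fst.snd.prodMk measurable_snd))

theorem universallyMeasurable_thresholdPolicy {Ra : 𝓗 → ℝ≥0∞} (hRa : UniversallyMeasurable Ra)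
    (hRh : UniversallyMeasurable Rh) {a : 𝓗 → 𝓐} (ha : UniversallyMeasurable a) :
    UniversallyMeasurable (thresholdPolicy Ra Rh a) := by
  classical
  have h : @MeasurableSet 𝓗 (universalCompletion 𝓗) {h | Ra h ≤ Rh h} :=
    measurableSet_le (mδ := universalCompletion 𝓗) hRa hRh
  exact Measurable.ite (m := universalCompletion 𝓗) h
    (@Measurable.comp _ _ _ (universalCompletion 𝓗) _ _ _ _ measurable_inl ha)
    (@measurable_const _ _ _ (universalCompletion 𝓗) _)

theorem responseRisk_thresholdPolicy_le {Ra : 𝓗 → ℝ≥0∞} {a : 𝓗 → 𝓐} {ε : ℝ≥0∞} {h : 𝓗}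
    (hε : Ra h ≤ Rh h → posteriorRisk ν ℓ h (a h) ≤ Ra h + ε) :
    responseRisk ν ℓ Rh h (thresholdPolicy Ra Rh a h) ≤ min (Ra h) (Rh h) + ε := by
  by_cases hle : Ra h ≤ Rh h
  · simpa [thresholdPolicy, hle, responseRisk] using hε hle
  · simp [thresholdPolicy, hle, responseRisk, min_eq_right (not_le.1 hle).le]

variable [StandardBorelSpace 𝓗] [StandardBorelSpace 𝓐]

/-- An infimum lies below c exactly when some action does, so strict sublevel sets are projections
of Borel sets. -/
theorem universallyMeasurable_minPosteriorRisk (hℓ : Measurable (Function.uncurry ℓ)) :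
    UniversallyMeasurable (minPosteriorRisk ν ℓ) := by
  refine measurable_of_Iio (mδ := universalCompletion 𝓗) fun c => ?_
  have : minPosteriorRisk ν ℓ ⁻¹' Set.Iio c =
      Prod.fst '' {p : 𝓗 × 𝓐 | posteriorRisk ν ℓ p.1 p.2 < c} := by
    ext h
    simp [minPosteriorRisk, iInf_lt_iff]
  rw [this]
  exact measurableSet_universalCompletion_image_fst
    (measurableSet_lt (measurable_posteriorRisk hℓ) measurable_const)

/-- Almost surely, actions can be chosen measurably with nearly minimal posterior risk. -/
theorem exists_approximate_minimizer [Nonempty 𝓐] (hℓ : Measurable (Function.uncurry ℓ))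
    (μ : Measure 𝓗) [IsFiniteMeasure μ] {ε : ℝ≥0∞} (hε : 0 < ε) :
    ∃ a : 𝓗 → 𝓐, UniversallyMeasurable a ∧
      ∀ᵐ h ∂μ, minPosteriorRisk ν ℓ h < ∞ →
        posteriorRisk ν ℓ h (a h) ≤ minPosteriorRisk ν ℓ h + ε := by
  have hm := (universallyMeasurable_minPosteriorRisk (ν := ν) hℓ).aemeasurable μ
  -- Selection requires a Borel set, hence the Borel version of R_a. The strict inequality has a
  -- solution only where that version is finite.
  have hB : MeasurableSet {p : 𝓗 × 𝓐 | posteriorRisk ν ℓ p.1 p.2 < hm.mk _ p.1 + ε} :=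
    measurableSet_lt (measurable_posteriorRisk hℓ)
      ((hm.measurable_mk.comp measurable_fst).add_const ε)
  obtain ⟨a, ha, hsel⟩ := exists_universallyMeasurable_selection hB
  refine ⟨a, ha, ?_⟩
  filter_upwards [hm.ae_eq_mk] with h hh hfin
  obtain ⟨b, hb⟩ := iInf_lt_iff.1 (ENNReal.lt_add_right hfin.ne hε.ne' :
    (⨅ b, posteriorRisk ν ℓ h b) < minPosteriorRisk ν ℓ h + ε)
  have := hsel h b (by rw [Set.mem_ofPred_eq, ← hh]; exact hb)
  rw [Set.mem_ofPred_eq, ← hh] at this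
  exact this.le

end Risk

end SelectiveReview

/-! ### Assembling the lower bound and the threshold rules. -/

open SelectiveReview in
theorem theorem3
    {Ω 𝓗 𝓐 𝓨 : Type*}
    [MeasurableSpace Ω] [StandardBorelSpace Ω]
    [MeasurableSpace 𝓗] [StandardBorelSpace 𝓗]
    [MeasurableSpace 𝓐] [StandardBorelSpace 𝓐] [Nonempty 𝓐]
    [MeasurableSpace 𝓨] [StandardBorelSpace 𝓨]
    (P : Measure Ω) [IsProbabilityMeasure P]
    (H : Ω → 𝓗) (hH : Measurable H)
    (Y : Ω → 𝓨) (hY : Measurable Y)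
    (ν : Kernel 𝓗 𝓨) [IsMarkovKernel ν] (hν : HasCondDistrib Y H ν P)
    (ℓ : 𝓐 → 𝓨 → ℝ≥0∞) (hℓ : Measurable (Function.uncurry ℓ))
    (Rh : 𝓗 → ℝ≥0∞) (hRh : UniversallyMeasurable Rh)
    (hRh_int : ∫⁻ ω, Rh (H ω) ∂P < ∞) :
    UniversallyMeasurable (minPosteriorRisk ν ℓ) ∧
    optimalLoss P H Y ℓ Rh = ∫⁻ ω, min (minPosteriorRisk ν ℓ (H ω)) (Rh (H ω)) ∂P ∧
    optimalRandomizedLoss P H Y ℓ Rh =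
      ∫⁻ ω, min (minPosteriorRisk ν ℓ (H ω)) (Rh (H ω)) ∂P ∧
    (∀ ε : ℝ≥0∞, 0 < ε →
      ∃ a : 𝓗 → 𝓐, UniversallyMeasurable a ∧
        UniversallyMeasurable (thresholdPolicy (minPosteriorRisk ν ℓ) Rh a) ∧
        policyLoss P H Y ℓ Rh (thresholdPolicy (minPosteriorRisk ν ℓ) Rh a)
          ≤ optimalLoss P H Y ℓ Rh + ε) ∧
    (∀ a : 𝓗 → 𝓐, UniversallyMeasurable a →
      (∀ᵐ ω ∂P, posteriorRisk ν ℓ (H ω) (a (H ω)) = minPosteriorRisk ν ℓ (H ω)) →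
        UniversallyMeasurable (thresholdPolicy (minPosteriorRisk ν ℓ) Rh a) ∧
        policyLoss P H Y ℓ Rh (thresholdPolicy (minPosteriorRisk ν ℓ) Rh a)
          = optimalLoss P H Y ℓ Rh) := by
  have : IsProbabilityMeasure (P.map H) := Measure.isProbabilityMeasure_map hH.aemeasurable
  have hRa : UniversallyMeasurable (minPosteriorRisk ν ℓ) :=
    universallyMeasurable_minPosteriorRisk hℓ
  have hlower : ∫⁻ ω, min (minPosteriorRisk ν ℓ (H ω)) (Rh (H ω)) ∂P ≤
      optimalRandomizedLoss P H Y ℓ Rh :=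
    le_iInf₂ fun Γ hΓ => lintegral_min_le_randomizedLoss hH hν hℓ hRh Γ
  have hrand : optimalRandomizedLoss P H Y ℓ Rh ≤ optimalLoss P H Y ℓ Rh :=
    le_iInf₂ fun δ hδ => (iInf₂_le (deterministicKernel hδ)
      (isMarkovKernel_deterministicKernel hδ)).trans_eq (randomizedLoss_deterministicKernel hℓ hδ)
  have happrox : ∀ ε : ℝ≥0∞, 0 < ε → ∃ a : 𝓗 → 𝓐, UniversallyMeasurable a ∧
      UniversallyMeasurable (thresholdPolicy (minPosteriorRisk ν ℓ) Rh a) ∧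
      policyLoss P H Y ℓ Rh (thresholdPolicy (minPosteriorRisk ν ℓ) Rh a) ≤
        ∫⁻ ω, min (minPosteriorRisk ν ℓ (H ω)) (Rh (H ω)) ∂P + ε := by
    intro ε hε
    obtain ⟨a, ha, hrisk⟩ := exists_approximate_minimizer (ν := ν) hℓ (P.map H) hε
    have hthr := universallyMeasurable_thresholdPolicy hRa hRh ha
    refine ⟨a, ha, hthr, ?_⟩
    rw [policyLoss_eq hH hν hℓ hRh hthr]
    -- Where the rule acts, R_a ≤ R_h < ∞ almost surely, which is the finiteness that the
    -- near-minimizer needs.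
    have hfin : ∀ᵐ ω ∂P, Rh (H ω) < ∞ :=
      ae_lt_top' ((hRh.aemeasurable (P.map H)).comp_measurable hH) hRh_int.ne
    calc ∫⁻ ω, responseRisk ν ℓ Rh (H ω)
          (thresholdPolicy (minPosteriorRisk ν ℓ) Rh a (H ω)) ∂P
        ≤ ∫⁻ ω, (min (minPosteriorRisk ν ℓ (H ω)) (Rh (H ω)) + ε) ∂P := by
          refine lintegral_mono_ae ?_
          filter_upwards [hfin, ae_of_ae_map hH.aemeasurable hrisk] with ω h1 h2
          exact responseRisk_thresholdPolicy_le fun hle => h2 (hle.trans_lt h1)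
      _ = _ := by simp [lintegral_add_right _ measurable_const]
  have hupper : optimalLoss P H Y ℓ Rh ≤
      ∫⁻ ω, min (minPosteriorRisk ν ℓ (H ω)) (Rh (H ω)) ∂P := by
    refine ENNReal.le_of_forall_pos_le_add fun ε hε _ => ?_
    obtain ⟨a, -, hthr, hle⟩ := happrox ε (by exact_mod_cast hε)
    exact (iInf₂_le _ hthr).trans hle
  have hopt : optimalLoss P H Y ℓ Rh =
      ∫⁻ ω, min (minPosteriorRisk ν ℓ (H ω)) (Rh (H ω)) ∂P :=
    hupper.antisymm (hlower.trans hrand)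
  refine ⟨hRa, hopt, (hrand.trans hupper).antisymm hlower, ?_, ?_⟩
  · rw [hopt]
    exact happrox
  · intro a ha hmin
    have hthr := universallyMeasurable_thresholdPolicy hRa hRh ha
    refine ⟨hthr, le_antisymm ?_ (iInf₂_le _ hthr)⟩
    rw [hopt, policyLoss_eq hH hν hℓ hRh hthr]
    refine lintegral_mono_ae ?_
    filter_upwards [hmin] with ω hω
    -- An exact minimizer is the case of zero error.
    simpa using responseRisk_thresholdPolicy_le (ε := 0) (Rh := Rh)
      (Ra := minPosteriorRisk ν ℓ) (a := a) fun _ => (hω.trans (add_zero _).symm).le
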